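/- Let $\Bbbk$ be a field, let $R=\Bbbk[x_0,\dots,x_n]$ with $n\ge 0$, and let $\mathfrak m=(x_0,\dots,x_n)$. For an ideal $I\subseteq R$ and an integer $m\ge 0$, let $$I^{(m)} = R\cap\bigcap_{P\in \mathrm{Ass}(R/I)} I^m R_P$$ denote the $m$-th symbolic power of $I$, where $P$ ranges over all associated primes of $I$ (embedded ones included); in particular $I^{(0)}=R$. Let $I\subsetneq R$ be a proper monomial ideal. Then for every integer $r\ge 0$, $$I^{(r+1)}\subseteq \mathfrak m\, I^{(r)}.$$ Consequently, for all integers $r,s\ge 0$, $$I^{(r+s)}\subseteq \mathfrak m^{s}\, I^{(r)}.$$ -/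

import Mathlib

/-- A monomial ideal of the polynomial ring `k[x_i : i ∈ σ]`: an ideal generated by a set of
monomials. -/
def IsMonomialIdeal {σ k : Type*} [CommSemiring k] (I : Ideal (MvPolynomial σ k)) : Prop :=
  ∃ A : Set (σ →₀ ℕ), I = Ideal.span ((fun a => MvPolynomial.monomial a (1 : k)) '' A)

/-- The `m`-th symbolic power `I^(m) = R ∩ ⋂_{P ∈ Ass(R/I)} I^m R_P`: the intersection, over all
associated primes `P` of `I` (embedded ones included), of the contractions to `R` of the
extensions of `I^m` to the localizations `R_P`. -/
noncomputable def symbolicPower {R : Type*} [CommRing R] (I : Ideal R) (m : ℕ) : Ideal R :=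
  ⨅ (P : PrimeSpectrum R) (_ : P.asIdeal ∈ associatedPrimes R (R ⧸ I)),
    ((I ^ m).map (algebraMap R (Localization.AtPrime P.asIdeal))).comap
      (algebraMap R (Localization.AtPrime P.asIdeal))

open MvPolynomial
open scoped Pointwise

section MonomialIdeals

variable {σ k : Type*} [Field k]

/-! Membership in the localization of a monomial ideal at a prime can be tested with monomial
denominators (`IsMonomialIdeal.exists_monomial_mul_mem`). Hence symbolic powers of `I` are monomial,
and it suffices to treat a monomial `x^a` of `I^(r+1)`. As `I^(r+1)` is proper, some `x_i` divides
`x^a`. At each associated prime, `x^b x^a ∈ I^(r+1)` (ordinary power) for some denominator `x^b`;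
removing `x_i` spoils at most one of the `r+1` factors from `I`, so `x^a / x_i` lies in the `r`-th
symbolic power. -/

theorem MvPolynomial.mem_of_forall_monomial_mem {J : Ideal (MvPolynomial σ k)}
    {f : MvPolynomial σ k} (h : ∀ a ∈ f.support, monomial a (1 : k) ∈ J) : f ∈ J := by
  rw [f.as_sum]
  refine J.sum_mem fun a ha => ?_
  rw [← mul_one (coeff a f), ← C_mul_monomial]
  exact J.mul_mem_left _ (h a ha)

theorem MvPolynomial.monomial_mem_of_le {J : Ideal (MvPolynomial σ k)} {a b : σ →₀ ℕ}
    (hab : a ≤ b) (ha : monomial a (1 : k) ∈ J) : monomial b (1 : k) ∈ J := by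
  rw [← tsub_add_cancel_of_le hab, ← one_mul (1 : k), ← monomial_mul]
  exact J.mul_mem_left _ ha

/-- An ideal is monomial if and only if it contains the monomials of each of its elements. -/
theorem isMonomialIdeal_iff {J : Ideal (MvPolynomial σ k)} :
    IsMonomialIdeal J ↔ ∀ f ∈ J, ∀ a ∈ f.support, monomial a (1 : k) ∈ J := by
  constructor
  · rintro ⟨A, rfl⟩ f hf a ha
    obtain ⟨b, hb, hba⟩ := mem_ideal_span_monomial_image.1 hf a ha
    exact monomial_mem_of_le hba (Ideal.subset_span ⟨b, hb, rfl⟩)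
  · intro h
    refine ⟨{a | monomial a (1 : k) ∈ J}, le_antisymm (fun f hf => ?_) ?_⟩
    · exact mem_ideal_span_monomial_image.2 fun a ha => ⟨a, h f hf a ha, le_rfl⟩
    · rw [Ideal.span_le]
      rintro _ ⟨a, ha, rfl⟩
      exact ha

theorem IsMonomialIdeal.exists_add_le_of_mem_mul {J K : Ideal (MvPolynomial σ k)}
    (hJ : IsMonomialIdeal J) (hK : IsMonomialIdeal K) {f : MvPolynomial σ k} (hf : f ∈ J * K)
    {a : σ →₀ ℕ} (ha : a ∈ f.support) :
    ∃ b c, monomial b (1 : k) ∈ J ∧ monomial c (1 : k) ∈ K ∧ b + c ≤ a := by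
  classical
  obtain ⟨A, rfl⟩ := hJ
  obtain ⟨B, rfl⟩ := hK
  have himage : ((fun a => monomial a (1 : k)) '' A) * ((fun a => monomial a (1 : k)) '' B) =
      (fun a => monomial a (1 : k)) '' Set.image2 (· + ·) A B := by
    rw [← Set.image2_mul, Set.image2_image_left, Set.image2_image_right, Set.image_image2]
    simp [monomial_mul]
  rw [Ideal.span_mul_span', himage] at hf
  obtain ⟨_, ⟨b, hb, c, hc, rfl⟩, hbc⟩ := mem_ideal_span_monomial_image.1 hf a ha
  exact ⟨b, c, Ideal.subset_span ⟨b, hb, rfl⟩, Ideal.subset_span ⟨c, hc, rfl⟩, hbc⟩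

theorem IsMonomialIdeal.mul {J K : Ideal (MvPolynomial σ k)}
    (hJ : IsMonomialIdeal J) (hK : IsMonomialIdeal K) : IsMonomialIdeal (J * K) := by
  rw [isMonomialIdeal_iff]
  intro f hf a ha
  obtain ⟨b, c, hb, hc, hbc⟩ := hJ.exists_add_le_of_mem_mul hK hf ha
  refine monomial_mem_of_le hbc ?_
  rw [← one_mul (1 : k), ← monomial_mul]
  exact Ideal.mul_mem_mul hb hc

theorem isMonomialIdeal_top : IsMonomialIdeal (⊤ : Ideal (MvPolynomial σ k)) :=
  isMonomialIdeal_iff.2 fun _ _ _ _ => Submodule.mem_top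

theorem IsMonomialIdeal.pow {J : Ideal (MvPolynomial σ k)} (hJ : IsMonomialIdeal J) :
    ∀ r : ℕ, IsMonomialIdeal (J ^ r)
  | 0 => by simpa [Ideal.one_eq_top] using isMonomialIdeal_top
  | r + 1 => by rw [pow_succ]; exact (hJ.pow r).mul hJ

/-- Dividing a monomial of `J ^ (r + 1)` by a variable yields a monomial of `J ^ r`. -/
theorem IsMonomialIdeal.monomial_sub_single_mem_pow {J : Ideal (MvPolynomial σ k)}
    (hJ : IsMonomialIdeal J) (i : σ) (r : ℕ) :
    ∀ {a : σ →₀ ℕ}, monomial a (1 : k) ∈ J ^ (r + 1) → a i ≠ 0 →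
      monomial (a - Finsupp.single i 1) (1 : k) ∈ J ^ r := by
  classical
  induction r with
  | zero => intros; simp
  | succ r ih =>
    intro a ha hai
    rw [pow_succ] at ha
    obtain ⟨b, c, hb, hc, hbc⟩ :=
      (hJ.pow (r + 1)).exists_add_le_of_mem_mul hJ ha (a := a)
        (by rw [mem_support_iff, coeff_monomial, if_pos rfl]; exact one_ne_zero)
    -- If `x_i` does not divide `x^b`, then `x^b` still divides the quotient; otherwise take `x_i`
    -- out of `x^b` by induction and keep `x^c`.
    by_cases hbi : b i = 0
    · refine monomial_mem_of_le (fun j => ?_) hb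
      have hj := hbc j
      by_cases hij : j = i
      · subst hij; simp [hbi]
      · simp only [Finsupp.add_apply] at hj
        rw [Finsupp.tsub_apply, Finsupp.single_eq_of_ne hij]
        omega
    · have hmul := Ideal.mul_mem_mul (ih hb hbi) hc
      rw [monomial_mul, one_mul, ← pow_succ] at hmul
      refine monomial_mem_of_le (fun j => ?_) hmul
      have hj := hbc j
      simp only [Finsupp.add_apply] at hj
      simp only [Finsupp.add_apply, Finsupp.tsub_apply]
      by_cases hij : j = i
      · subst hij; rw [Finsupp.single_eq_same]; omega
      · rw [Finsupp.single_eq_of_ne hij]; omega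

section Leading

variable [LinearOrder σ] [WellFoundedGT σ]

/-- If `f * g` lies in a monomial ideal, so does the product of `g` with some power of the
leading monomial of `f`. -/
theorem IsMonomialIdeal.exists_monomial_degree_pow_mul_mem {J : Ideal (MvPolynomial σ k)}
    (hJ : IsMonomialIdeal J) {f : MvPolynomial σ k} (hf : f ≠ 0) (g : MvPolynomial σ k)
    (hfg : f * g ∈ J) :
    ∃ N : ℕ, monomial (MonomialOrder.lex.degree f) (1 : k) ^ N * g ∈ J := by
  classical
  set a := MonomialOrder.lex.degree f with ha
  -- The leading monomial of `f * g` lies in `J`, so `g` can be replaced by `x^a` times `g` without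
  -- its leading term, which has fewer terms.
  induction hn : g.support.card using Nat.strong_induction_on generalizing g with
  | _ n ih =>
    by_cases hg : g = 0
    · exact ⟨0, by simp [hg]⟩
    set b := MonomialOrder.lex.degree g with hb
    have hab : monomial (a + b) (1 : k) ∈ J := by
      refine isMonomialIdeal_iff.1 hJ _ hfg _ ?_
      rw [mem_support_iff, ha, hb, MonomialOrder.coeff_mul_of_degree_add]
      exact mul_ne_zero (MonomialOrder.leadingCoeff_ne_zero_iff.2 hf)
        (MonomialOrder.leadingCoeff_ne_zero_iff.2 hg)
    have hterm : monomial a (1 : k) * monomial b (coeff b g) ∈ J := by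
      rw [monomial_mul, one_mul, ← mul_one (coeff b g), ← C_mul_monomial]
      exact J.mul_mem_left _ hab
    set h := g - monomial b (coeff b g) with hh
    have hsupp : h.support ⊆ g.support.erase b := by
      intro c hc
      rw [mem_support_iff, hh, coeff_sub, coeff_monomial] at hc
      rw [Finset.mem_erase, mem_support_iff]
      by_cases hcb : b = c
      · subst hcb; simp at hc
      · rw [if_neg hcb, sub_zero] at hc
        exact ⟨Ne.symm hcb, hc⟩
    have hcard : (monomial a (1 : k) * h).support.card < n := by
      calc (monomial a (1 : k) * h).support.card
          ≤ ((monomial a (1 : k)).support + h.support).card :=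
            Finset.card_le_card (support_mul _ _)
        _ ≤ (monomial a (1 : k)).support.card * h.support.card := Finset.card_add_le
        _ = h.support.card := by rw [support_monomial]; simp
        _ ≤ (g.support.erase b).card := Finset.card_le_card hsupp
        _ < n := hn ▸ Finset.card_erase_lt_of_mem (MonomialOrder.degree_mem_support hg)
    obtain ⟨N, hN⟩ := ih _ hcard (monomial a (1 : k) * h) (by
      have : f * (monomial a (1 : k) * h) = monomial a (1 : k) * (f * g) -
          f * (monomial a (1 : k) * monomial b (coeff b g)) := by rw [hh]; ring
      rw [this]
      exact J.sub_mem (J.mul_mem_left _ hfg) (J.mul_mem_left _ hterm)) rfl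
    refine ⟨N + 1, ?_⟩
    have : monomial a (1 : k) ^ (N + 1) * g = monomial a (1 : k) ^ N * (monomial a (1 : k) * h) +
        monomial a (1 : k) ^ N * (monomial a (1 : k) * monomial b (coeff b g)) := by
      rw [hh]; ring
    rw [this]
    exact J.add_mem hN (J.mul_mem_left _ hterm)

/-- A prime ideal of the form `J : g` with `J` monomial is monomial. -/
theorem IsMonomialIdeal.of_isPrime_of_mem_iff {J P : Ideal (MvPolynomial σ k)}
    (hJ : IsMonomialIdeal J) (hP : P.IsPrime) {g : MvPolynomial σ k}
    (hPg : ∀ f, f ∈ P ↔ f * g ∈ J) : IsMonomialIdeal P := by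
  classical
  rw [isMonomialIdeal_iff]
  intro f hf
  induction hn : f.support.card using Nat.strong_induction_on generalizing f with
  | _ n ih =>
    intro c hc
    have hf0 : f ≠ 0 := by rintro rfl; simp at hc
    set a := MonomialOrder.lex.degree f with ha
    have haP : monomial a (1 : k) ∈ P := by
      obtain ⟨N, hN⟩ := hJ.exists_monomial_degree_pow_mul_mem hf0 g ((hPg f).1 hf)
      exact hP.mem_of_pow_mem N ((hPg _).2 hN)
    by_cases hca : a = c
    · exact hca ▸ haP
    have hcoeff : ∀ d, coeff d (f - monomial a (coeff a f)) = if a = d then 0 else coeff d f := by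
      intro d
      rw [coeff_sub, coeff_monomial]
      split_ifs with h
      · rw [h, sub_self]
      · rw [sub_zero]
    refine ih _ ?_ (f - monomial a (coeff a f)) (P.sub_mem hf ?_) rfl c ?_
    · rw [← hn]
      refine Finset.card_lt_card ⟨fun d hd => ?_, fun h => ?_⟩
      · rw [mem_support_iff, hcoeff] at hd
        rw [mem_support_iff]
        exact fun h => hd (by simp [h])
      · have := h (MonomialOrder.lex.degree_mem_support hf0)
        rw [mem_support_iff, hcoeff] at this
        simp [ha] at this
    · rw [← mul_one (coeff a f), ← C_mul_monomial]
      exact P.mul_mem_left _ haP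
    · rw [mem_support_iff, hcoeff, if_neg hca]
      exact mem_support_iff.1 hc

end Leading

end MonomialIdeals

theorem exists_mem_iff_mul_mem_of_mem_associatedPrimes {R : Type*} [CommRing R] [IsNoetherianRing R]
    {J P : Ideal R} (hP : P ∈ associatedPrimes R (R ⧸ J)) : ∃ g, ∀ f, f ∈ P ↔ f * g ∈ J := by
  obtain ⟨-, x, hx⟩ := isAssociatedPrime_iff.1 hP
  obtain ⟨g, rfl⟩ := Ideal.Quotient.mk_surjective x
  refine ⟨g, fun f => ?_⟩
  rw [hx, Submodule.mem_colon_singleton, Submodule.mem_bot, ← Ideal.Quotient.eq_zero_iff_mem,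
    map_mul]
  rfl

theorem le_of_mem_associatedPrimes_quotient {R : Type*} [CommRing R] [IsNoetherianRing R]
    {J P : Ideal R} (hP : P ∈ associatedPrimes R (R ⧸ J)) : J ≤ P := by
  obtain ⟨g, hg⟩ := exists_mem_iff_mul_mem_of_mem_associatedPrimes hP
  exact fun f hf => (hg f).2 (J.mul_mem_right g hf)

theorem mem_symbolicPower_iff {R : Type*} [CommRing R] {I : Ideal R} {m : ℕ} {f : R} :
    f ∈ symbolicPower I m ↔
      ∀ P ∈ associatedPrimes R (R ⧸ I), ∃ s, s ∉ P ∧ s * f ∈ I ^ m := by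
  simp only [symbolicPower, Submodule.mem_iInf, Ideal.mem_comap]
  constructor
  · intro h P hP
    have := hP.isPrime
    exact (IsLocalization.algebraMap_mem_map_algebraMap_iff P.primeCompl _ (I ^ m) f).1
      (h ⟨P, this⟩ hP)
  · intro h P hP
    rw [IsLocalization.algebraMap_mem_map_algebraMap_iff P.asIdeal.primeCompl]
    exact h P.asIdeal hP

section Associated

variable {σ k : Type*} [Field k] [LinearOrder σ] [Finite σ]

theorem IsMonomialIdeal.of_mem_associatedPrimes {J P : Ideal (MvPolynomial σ k)}
    (hJ : IsMonomialIdeal J) (hP : P ∈ associatedPrimes _ (MvPolynomial σ k ⧸ J)) :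
    IsMonomialIdeal P := by
  obtain ⟨g, hg⟩ := exists_mem_iff_mul_mem_of_mem_associatedPrimes hP
  exact hJ.of_isPrime_of_mem_iff hP.isPrime hg

/-- Membership in the localization of a monomial ideal at a monomial prime is witnessed by a
monomial denominator. -/
theorem IsMonomialIdeal.exists_monomial_mul_mem {J P : Ideal (MvPolynomial σ k)}
    (hJ : IsMonomialIdeal J) [hP : P.IsPrime] {s f : MvPolynomial σ k} (hs : s ∉ P)
    (hsf : s * f ∈ J) : ∃ a, monomial a (1 : k) ∉ P ∧ monomial a (1 : k) * f ∈ J := by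
  -- `T` is `J` saturated at the monomials outside `P`. The claim is `f ∈ T`; otherwise `s` is a
  -- zero divisor modulo `T`.
  let T : Ideal (MvPolynomial σ k) :=
    { carrier := {f | ∃ a, monomial a (1 : k) ∉ P ∧ monomial a (1 : k) * f ∈ J}
      zero_mem' := ⟨0, by
        simpa using (Ideal.ne_top_iff_one P).1 hP.ne_top, by simp⟩
      add_mem' := by
        rintro x y ⟨a, ha, hax⟩ ⟨b, hb, hby⟩
        refine ⟨a + b, ?_, ?_⟩ <;> rw [← one_mul (1 : k), ← monomial_mul]
        · exact fun h => (hP.mem_or_mem h).elim ha hb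
        · have : monomial a (1 : k) * monomial b 1 * (x + y) =
              monomial b 1 * (monomial a 1 * x) + monomial a 1 * (monomial b 1 * y) := by ring
          rw [this]
          exact J.add_mem (J.mul_mem_left _ hax) (J.mul_mem_left _ hby)
      smul_mem' := by
        rintro c x ⟨a, ha, hax⟩
        refine ⟨a, ha, ?_⟩
        rw [smul_eq_mul, mul_left_comm]
        exact J.mul_mem_left _ hax }
  have mem_T {f} : f ∈ T ↔ ∃ a, monomial a (1 : k) ∉ P ∧ monomial a (1 : k) * f ∈ J := Iff.rfl
  have hT : IsMonomialIdeal T := by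
    rw [isMonomialIdeal_iff]
    rintro x ⟨a, ha, hax⟩ b hb
    refine ⟨a, ha, ?_⟩
    rw [monomial_mul, one_mul]
    refine isMonomialIdeal_iff.1 hJ _ hax _ ?_
    rw [mem_support_iff, coeff_monomial_mul, one_mul]
    exact mem_support_iff.1 hb
  rw [← mem_T]
  by_contra hfT
  have hzero : s ∈ ⋃ Q ∈ associatedPrimes (MvPolynomial σ k) (MvPolynomial σ k ⧸ T),
      (Q : Set (MvPolynomial σ k)) := by
    rw [biUnion_associatedPrimes_eq_zero_divisors]
    refine ⟨Ideal.Quotient.mk T f, mt Ideal.Quotient.eq_zero_iff_mem.1 hfT, ?_⟩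
    have hsT : Ideal.Quotient.mk T (s * f) = 0 := Ideal.Quotient.eq_zero_iff_mem.2
      ⟨0, by simpa using (Ideal.ne_top_iff_one P).1 hP.ne_top, by simpa using hsf⟩
    rwa [map_mul] at hsT
  simp only [Set.mem_iUnion, SetLike.mem_coe, exists_prop] at hzero
  obtain ⟨Q, hQ, hsQ⟩ := hzero
  obtain ⟨g, hg⟩ := exists_mem_iff_mul_mem_of_mem_associatedPrimes hQ
  -- `Q` is monomial, so it contains every monomial of `s`. One outside `P` is invertible modulo the
  -- saturation, which forces `g ∈ T` and `1 ∈ Q`.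
  refine hs (mem_of_forall_monomial_mem fun a ha => ?_)
  by_contra haP
  have haQ := isMonomialIdeal_iff.1 (hT.of_mem_associatedPrimes hQ) s hsQ a ha
  obtain ⟨b, hbP, hb⟩ := (hg _).1 haQ
  refine (Ideal.ne_top_iff_one Q).1 hQ.isPrime.ne_top ((hg 1).2 ⟨b + a, ?_, ?_⟩) <;>
    rw [← one_mul (1 : k), ← monomial_mul]
  · exact fun h => (hP.mem_or_mem h).elim hbP haP
  · rwa [one_mul, mul_assoc]

theorem IsMonomialIdeal.symbolicPower {I : Ideal (MvPolynomial σ k)} (hI : IsMonomialIdeal I)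
    (m : ℕ) : IsMonomialIdeal (symbolicPower I m) := by
  rw [isMonomialIdeal_iff]
  intro f hf a ha
  rw [mem_symbolicPower_iff] at hf ⊢
  intro P hP
  obtain ⟨s, hs, hsf⟩ := hf P hP
  have := hP.isPrime
  obtain ⟨b, hb, hbf⟩ := (hI.pow m).exists_monomial_mul_mem hs hsf
  refine ⟨monomial b 1, hb, ?_⟩
  rw [monomial_mul, one_mul]
  refine isMonomialIdeal_iff.1 (hI.pow m) _ hbf _ ?_
  rw [mem_support_iff, coeff_monomial_mul, one_mul]
  exact mem_support_iff.1 ha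

theorem IsMonomialIdeal.monomial_sub_single_mem_symbolicPower {I : Ideal (MvPolynomial σ k)}
    (hI : IsMonomialIdeal I) {r : ℕ} {a : σ →₀ ℕ}
    (ha : monomial a (1 : k) ∈ _root_.symbolicPower I (r + 1)) {i : σ} (hi : a i ≠ 0) :
    monomial (a - Finsupp.single i 1) (1 : k) ∈ _root_.symbolicPower I r := by
  rw [mem_symbolicPower_iff] at ha ⊢
  intro P hP
  obtain ⟨s, hs, hsa⟩ := ha P hP
  have := hP.isPrime
  obtain ⟨b, hb, hba⟩ := (hI.pow (r + 1)).exists_monomial_mul_mem hs hsa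
  refine ⟨monomial b 1, hb, ?_⟩
  rw [monomial_mul, one_mul] at hba ⊢
  rw [← add_tsub_assoc_of_le (Finsupp.single_le_iff.2 (Nat.one_le_iff_ne_zero.2 hi))]
  exact hI.monomial_sub_single_mem_pow i r hba (by simp [hi])

/-- `R ⧸ I` is nonzero and so has an associated prime `P`; a denominator for `1` would lie in `I ≤
P`. Exponent `0` must be excluded. -/
theorem symbolicPower_succ_ne_top {R : Type*} [CommRing R] [IsNoetherianRing R] {I : Ideal R}
    (hI : I ≠ ⊤) (r : ℕ) : symbolicPower I (r + 1) ≠ ⊤ := by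
  rw [Ideal.ne_top_iff_one, mem_symbolicPower_iff]
  intro h
  have := Ideal.Quotient.nontrivial_iff.2 hI
  obtain ⟨P, hP⟩ := associatedPrimes.nonempty R (R ⧸ I)
  obtain ⟨s, hs, hsI⟩ := h P hP
  rw [mul_one] at hsI
  exact hs (le_of_mem_associatedPrimes_quotient hP (Ideal.pow_le_self r.succ_ne_zero hsI))

theorem IsMonomialIdeal.symbolicPower_succ_le {I : Ideal (MvPolynomial σ k)}
    (hI : IsMonomialIdeal I) (hI_proper : I ≠ ⊤) (r : ℕ) :
    _root_.symbolicPower I (r + 1) ≤ idealOfVars σ k * _root_.symbolicPower I r := by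
  intro f hf
  refine mem_of_forall_monomial_mem fun a ha => ?_
  have haI := isMonomialIdeal_iff.1 (hI.symbolicPower (r + 1)) f hf a ha
  have ha0 : a ≠ 0 := by
    rintro rfl
    exact (Ideal.ne_top_iff_one _).1 (symbolicPower_succ_ne_top hI_proper r) haI
  obtain ⟨i, hi⟩ := Finsupp.ne_iff.1 ha0
  have hle : Finsupp.single i 1 ≤ a := Finsupp.single_le_iff.2 (Nat.one_le_iff_ne_zero.2 hi)
  rw [← add_tsub_cancel_of_le hle, ← one_mul (1 : k), ← monomial_mul]
  exact Ideal.mul_mem_mul (Ideal.subset_span ⟨i, rfl⟩)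
    (hI.monomial_sub_single_mem_symbolicPower haI hi)

end Associated

theorem mainTheorem8 {k : Type*} [Field k] (n : ℕ)
    (I : Ideal (MvPolynomial (Fin (n + 1)) k)) (hI : IsMonomialIdeal I) (hI_proper : I ≠ ⊤) :
    (∀ r : ℕ, symbolicPower I (r + 1) ≤
        MvPolynomial.idealOfVars (Fin (n + 1)) k * symbolicPower I r) ∧
    (∀ r s : ℕ, symbolicPower I (r + s) ≤
        MvPolynomial.idealOfVars (Fin (n + 1)) k ^ s * symbolicPower I r) := by
  refine ⟨hI.symbolicPower_succ_le hI_proper, fun r s => ?_⟩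
  induction s with
  | zero => simp
  | succ s ih =>
    rw [← add_assoc, pow_succ', mul_assoc]
    exact (hI.symbolicPower_succ_le hI_proper (r + s)).trans (Ideal.mul_mono_right ih)
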